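/- Let $d\in\mathbb N$ and let $V_{\rm odd},V_{\rm even}\subset\mathbb R^d$ be finite sets with $V_{\rm odd}=-V_{\rm even}$, $V_{\rm odd}\cap V_{\rm even}=\emptyset$ and $m:=\#V_{\rm odd}\ge 2$; put $V=V_{\rm odd}\cup V_{\rm even}$. Let $\mathcal S_{\rm even},\mathcal S_{\rm odd}\subset\mathbb R^d$ satisfy $0\in\mathcal S_{\rm even}$, $x+v\in\mathcal S_{\rm odd}$ for $x\in\mathcal S_{\rm even}$, $v\in V_{\rm odd}$, and $x+v\in\mathcal S_{\rm even}$ for $x\in\mathcal S_{\rm odd}$, $v\in V_{\rm even}$. For $k\ge 1$ put $V_k=V_{\rm odd}$ if $k$ is odd and $V_k=V_{\rm even}$ if $k$ is even. Fix $p,q\in[0,1]$. On a probability space, let $X_1$ be uniformly distributed on $V_{\rm odd}$, let $\mathcal U_n$ ($n\ge1$) be uniformly distributed on $\{1,\dots,n\}$, and let $G_k(v)$ ($k\ge2$, $v\in V$) be $V_k$-valued random variables such that, for $w\in V_k$, $$ \mathbb P(G_k(v)=w)=\begin{cases} p & v\in V_k,\ w=v,\\ \frac{1-p}{m-1} & v\in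 V_k,\ w\ne v,\\ q & v\notin V_k,\ w=-v,\\ \frac{1-q}{m-1} & v\notin V_k,\ w\neq -v.\end{cases} $$ Assume that the $\sigma$-fields $\sigma(X_1)$, $\sigma(\mathcal U_1,\{G_2(v)\}_{v\in V})$, $\sigma(\mathcal U_2,\{G_3(v)\}_{v\in V}),\dots$ are independent, and that $\mathcal U_n$ and $G_{n+1}(v)$ are independent for every $n\ge1$ and $v\in V$. The elephant random walk is defined by $$ X_{n+1}=G_{n+1}(X_{\mathcal U_n})\quad(n\ge1),\qquad S_n=X_1+\dots+X_n\quad(n\ge 0). $$ Put $$ \alpha=\frac{mp-1}{m-1},\qquad \beta=\frac{mq-1}{m-1},\qquad \gamma=\frac{\alpha+\beta}{2},\qquad \delta=\frac{\alpha-\beta}{2}. $$ **Theorem.** Assume that $\gamma<1$ and $\delta<1/2$. Then, for every $\eta>0$, $$ |S_n|=o\Big(\sqrt{n(\log n)^{1+\eta}}\Big)\quad\text{almost surely as } n\to\infty, $$ where $|\cdot|$ is the Euclidean norm. -/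

import Mathlib

open MeasureTheory ProbabilityTheory Filter Asymptotics

noncomputable section

/-- Position sets and step sets in `ℝ^d`: from a point of `Seven` the walk steps by a vector
of `Vodd` into `Sodd`, and from a point of `Sodd` by a vector of `Veven = -Vodd` into `Seven`.
The finite step sets are disjoint and have at least two elements. -/
structure ERWLattice (d : ℕ) where
  Seven : Set (EuclideanSpace ℝ (Fin d))
  Sodd : Set (EuclideanSpace ℝ (Fin d))
  Vodd : Finset (EuclideanSpace ℝ (Fin d))
  Veven : Finset (EuclideanSpace ℝ (Fin d))
  add_mem_Sodd : ∀ x ∈ Seven, ∀ v ∈ Vodd, x + v ∈ Sodd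
  add_mem_Seven : ∀ x ∈ Sodd, ∀ v ∈ Veven, x + v ∈ Seven
  mem_Vodd_iff : ∀ v, v ∈ Vodd ↔ -v ∈ Veven
  zero_mem_Seven : 0 ∈ Seven
  disjoint_V : Disjoint Vodd Veven
  two_le_card : 2 ≤ Vodd.card

namespace ERWLattice

variable {d : ℕ} (L : ERWLattice d)

/-- The number `m` of elements of `Vodd` (equivalently, of `Veven`). -/
def m : ℕ := L.Vodd.card

/-- The set `V = Vodd ∪ Veven` of all steps. -/
def V : Set (EuclideanSpace ℝ (Fin d)) := {v | v ∈ L.Vodd ∨ v ∈ L.Veven}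

/-- The steps available at time `k`: `Vodd` for odd `k`, `Veven` for even `k`. -/
def stepsAt (k : ℕ) : Finset (EuclideanSpace ℝ (Fin d)) :=
  if Odd k then L.Vodd else L.Veven

/-- `α = (m p - 1) / (m - 1)`. -/
def alpha (p : ℝ) : ℝ := ((L.m : ℝ) * p - 1) / ((L.m : ℝ) - 1)

/-- `β = (m q - 1) / (m - 1)`. -/
def beta (q : ℝ) : ℝ := ((L.m : ℝ) * q - 1) / ((L.m : ℝ) - 1)

/-- `γ = (α + β) / 2`. -/
def gamma (p q : ℝ) : ℝ := (L.alpha p + L.beta q) / 2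

/-- `δ = (α - β) / 2`. -/
def delta (p q : ℝ) : ℝ := (L.alpha p - L.beta q) / 2

open Classical in
/-- The probability that the elephant makes the step `w` at time `k` when it remembers the
step `v`. If `v` is available at time `k`, then `v` itself is repeated with probability `p` and
every other available step has probability `(1 - p) / (m - 1)`. Otherwise `-v` is available; it
has probability `q` and every other available step has probability `(1 - q) / (m - 1)`. -/
def stepProb (p q : ℝ) (k : ℕ) (v w : EuclideanSpace ℝ (Fin d)) : ℝ :=
  if v ∈ L.stepsAt k then
    if w = v then p else (1 - p) / ((L.m : ℝ) - 1)
  else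
    if w = -v then q else (1 - q) / ((L.m : ℝ) - 1)

end ERWLattice

/-- The independent blocks of randomness: `σ(X₁)` for `n = 0`, and
`σ(U_n, {G_{n+1}(v)}_{v ∈ V})` for `n ≥ 1`. -/
@[reducible] def erwBlock {d : ℕ} {Ω : Type*} (L : ERWLattice d)
    (X : ℕ → Ω → EuclideanSpace ℝ (Fin d)) (U : ℕ → Ω → ℕ)
    (G : ℕ → EuclideanSpace ℝ (Fin d) → Ω → EuclideanSpace ℝ (Fin d)) :
    ℕ → MeasurableSpace Ω
  | 0 => MeasurableSpace.comap (X 1) inferInstance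
  | n + 1 => MeasurableSpace.comap (U (n + 1)) inferInstance ⊔
      ⨆ v ∈ L.V, MeasurableSpace.comap (G (n + 2) v) inferInstance

/-- `X 1, X 2, …` are the increments of the elephant random walk with parameters `p, q`,
driven by the uniform times `U 1, U 2, …` and the responses `G k v` (`k ≥ 2`, `v ∈ V`).
The values `X 0`, `U 0`, `G 0`, `G 1` and `G k v` for `v ∉ V` are irrelevant. -/
structure IsERW {d : ℕ} {Ω : Type*} [MeasurableSpace Ω] (μ : Measure Ω)
    (L : ERWLattice d) (p q : ℝ)
    (X : ℕ → Ω → EuclideanSpace ℝ (Fin d)) (U : ℕ → Ω → ℕ)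
    (G : ℕ → EuclideanSpace ℝ (Fin d) → Ω → EuclideanSpace ℝ (Fin d)) : Prop where
  measurable_first : Measurable (X 1)
  measurable_U : ∀ n, 1 ≤ n → Measurable (U n)
  measurable_G : ∀ k, 2 ≤ k → ∀ v ∈ L.V, Measurable (G k v)
  /-- `X 1` is uniformly distributed on `Vodd`. -/
  first_mem : ∀ ω, X 1 ω ∈ L.Vodd
  first_law : ∀ w ∈ L.Vodd, μ.real {ω | X 1 ω = w} = 1 / (L.m : ℝ)
  /-- `U n` is uniformly distributed on `{1, …, n}`. -/
  U_mem : ∀ n, 1 ≤ n → ∀ ω, U n ω ∈ Finset.Icc 1 n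
  U_law : ∀ n, 1 ≤ n → ∀ j ∈ Finset.Icc 1 n, μ.real {ω | U n ω = j} = 1 / (n : ℝ)
  /-- `G k v` is distributed on the steps available at time `k` according to `stepProb`. -/
  G_mem : ∀ k, 2 ≤ k → ∀ v ∈ L.V, ∀ ω, G k v ω ∈ L.stepsAt k
  G_law : ∀ k, 2 ≤ k → ∀ v ∈ L.V, ∀ w ∈ L.stepsAt k,
    μ.real {ω | G k v ω = w} = L.stepProb p q k v w
  indep_blocks : iIndep (erwBlock L X U G) μ
  indep_U_G : ∀ n, 1 ≤ n → ∀ v ∈ L.V, IndepFun (U n) (G (n + 1) v) μ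
  /-- `X_{n+1} = G_{n+1}(X_{U_n})`. -/
  step : ∀ n, 1 ≤ n → ∀ ω, X (n + 1) ω = G (n + 1) (X (U n ω) ω) ω

/-- The position process `S_n = X_1 + ⋯ + X_n` (so `S_0 = 0`). -/
def erwPosition {d : ℕ} {Ω : Type*} (X : ℕ → Ω → EuclideanSpace ℝ (Fin d))
    (n : ℕ) (ω : Ω) : EuclideanSpace ℝ (Fin d) :=
  ∑ k ∈ Finset.Icc 1 n, X k ω

end

/-! Fix a coordinate `i`, flip its sign at even times and subtract its mean over `Vodd`, giving `z
k`. Under the uniform law on the available steps `z` has mean zero, so the response to a remembered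
step only multiplies its centred coordinate, by `α` if the parities agree and by `β` otherwise
(`stepMean_centredCoord`). Averaging over the uniform remembered time, the conditional mean of `z (n
+ 1)` is `γ A n / n + δ s (B n / n)`, where `s = altSign (n + 1)` and `A`, `B` are the plain and
alternating sums of `z`; up to a bounded term, `B` is the coordinate of the walk.

Hence `B (n + 1) = (1 + δ / n) B n + γ s (A n / n) + ξ n` with bounded martingale differences `ξ`.
The `γ` term is bounded, alternating and slowly varying, so subtracting `γ / 2 * altSign n * (A n /
n)` from `B n` leaves an error `O(1 / n)`.

Divide by the rate `b n = √(n (log n)^(1+η))`. Since `b n / b (n + 1) ≤ 1 - 1 / (2 (n + 1))`, the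
condition `δ < 1/2` makes the linear factor at most `1 - c / n` for large `n`, for some `c > 0`. As
`∑ 1 / b n ^ 2 < ∞`, the weighted noise is an `L²`-bounded martingale and converges almost surely,
and the weighted errors are summable. A contraction with divergent total rate and convergent forcing
series tends to zero. -/

open scoped Topology

/-! ### Contracting recursions with convergent forcing -/

/-- If `W (n + 1) = (1 - κ n) * W n + x n` with `κ n ∈ [0, 1]`, `∑ κ n = ∞` and `∑ x n`
convergent, then `W n → 0`. -/
theorem tendsto_zero_of_contracting_recursion {W x κ : ℕ → ℝ} {N : ℕ} {l : ℝ}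
    (hW : ∀ n, N ≤ n → W (n + 1) = (1 - κ n) * W n + x n)
    (hκ0 : ∀ n, N ≤ n → 0 ≤ κ n) (hκ1 : ∀ n, N ≤ n → κ n ≤ 1) (hκ : ¬ Summable κ)
    (hx : Tendsto (fun n => ∑ k ∈ Finset.range n, x k) atTop (𝓝 l)) :
    Tendsto W atTop (𝓝 0) := by
  set P : ℕ → ℝ := fun n => ∑ k ∈ Finset.range n, x k with hP
  have hPl : Tendsto (fun n => l - P n) atTop (𝓝 0) := by
    simpa using hx.const_sub l
  -- Nothing is assumed about `κ` before `N`; zeroing it there makes the partial sums monotone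
  -- without affecting divergence.
  set κ' : ℕ → ℝ := fun n => if N ≤ n then κ n else 0 with hκ'
  have hκ'0 : ∀ n, 0 ≤ κ' n := by
    intro n
    simp only [hκ']
    split_ifs with h
    exacts [hκ0 n h, le_rfl]
  have hκ's : ¬ Summable κ' := by
    intro h
    refine hκ ((summable_congr_atTop ?_).1 h)
    filter_upwards [eventually_ge_atTop N] with n hn
    simp [hκ', hn]
  have hK : Tendsto (fun n => ∑ k ∈ Finset.range n, κ' k) atTop atTop :=
    (not_summable_iff_tendsto_nat_atTop_of_nonneg hκ'0).1 hκ's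
  set K : ℕ → ℝ := fun n => ∑ k ∈ Finset.range n, κ' k with hKdef
  -- Adding the tail `l - P n` turns the forcing into `κ n * (l - P n)`: each step is then a convex
  -- combination of the previous value and a null sequence.
  have hV : Tendsto (fun n => W n + (l - P n)) atTop (𝓝 0) := by
    rw [Metric.tendsto_atTop]
    intro ε hε
    obtain ⟨N₁, hN₁⟩ := (Metric.tendsto_atTop.1 hPl) (ε / 2) (half_pos hε)
    set M := max N N₁
    set C := |W M + (l - P M)|
    have key : ∀ n, M ≤ n → |W n + (l - P n)| ≤ ε / 2 + C * Real.exp (K M - K n) := by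
      intro n hn
      induction n, hn using Nat.le_induction with
      | base => simp only [sub_self, Real.exp_zero, mul_one]; simp only [C]; linarith
      | succ n hn ih =>
        have hNn : N ≤ n := (le_max_left _ _).trans hn
        have h1 : W (n + 1) + (l - P (n + 1))
            = (1 - κ n) * (W n + (l - P n)) + κ n * (l - P n) := by
          simp only [hP, Finset.sum_range_succ, hW n hNn]
          ring
        have h2 : |l - P n| ≤ ε / 2 := by
          have := hN₁ n ((le_max_right _ _).trans hn)
          rw [Real.dist_eq, sub_zero] at this
          exact this.le
        have h3 : Real.exp (K M - K (n + 1)) = Real.exp (K M - K n) * Real.exp (-κ n) := by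
          rw [← Real.exp_add]
          congr 1
          simp only [hKdef, Finset.sum_range_succ, hκ', hNn, if_true]
          ring
        have h4 : 1 - κ n ≤ Real.exp (-κ n) := by
          have := Real.add_one_le_exp (-κ n)
          linarith
        have hκn := hκ0 n hNn
        have h5 : 0 ≤ 1 - κ n := by linarith [hκ1 n hNn]
        rw [h1, h3]
        calc |(1 - κ n) * (W n + (l - P n)) + κ n * (l - P n)|
            ≤ (1 - κ n) * |W n + (l - P n)| + κ n * |l - P n| := by
              refine (abs_add_le _ _).trans_eq ?_
              rw [abs_mul, abs_mul, abs_of_nonneg h5, abs_of_nonneg hκn]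
          _ ≤ (1 - κ n) * (ε / 2 + C * Real.exp (K M - K n)) + κ n * (ε / 2) := by gcongr
          _ = ε / 2 + C * Real.exp (K M - K n) * (1 - κ n) := by ring
          _ ≤ ε / 2 + C * Real.exp (K M - K n) * Real.exp (-κ n) := by gcongr
          _ = _ := by ring
    have hE : Tendsto (fun n => C * Real.exp (K M - K n)) atTop (𝓝 0) := by
      have : Tendsto (fun n => K M - K n) atTop atBot := by
        simp_rw [sub_eq_add_neg]
        exact tendsto_atBot_add_const_left _ _ (tendsto_neg_atTop_atBot.comp hK)
      simpa using (Real.tendsto_exp_atBot.comp this).const_mul C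
    obtain ⟨N₂, hN₂⟩ := (hE.eventually (gt_mem_nhds (half_pos hε))).exists_forall_of_atTop
    refine ⟨max M N₂, fun n hn => ?_⟩
    rw [Real.dist_eq, sub_zero]
    have := key n ((le_max_left _ _).trans hn)
    have := hN₂ n ((le_max_right _ _).trans hn)
    linarith
  simpa using hV.sub hPl

/-! ### The rate and recursions measured against it -/

/-- Cauchy condensation reduces the series to a multiple of `∑ k ^ (-(1 + η))`. Replacing `n` by
`max n 2` inside the logarithm keeps it positive. -/
theorem summable_inv_mul_log_rpow {η : ℝ} (hη : 0 < η) :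
    Summable fun n : ℕ => ((n : ℝ) * Real.log n ^ (1 + η))⁻¹ := by
  set f : ℕ → ℝ := fun n => ((n : ℝ) * Real.log (max n 2 : ℕ) ^ (1 + η))⁻¹ with hf
  have hlog : ∀ n : ℕ, 0 < Real.log (max n 2 : ℕ) := by
    intro n
    refine Real.log_pos ?_
    have : 2 ≤ max n 2 := le_max_right _ _
    exact_mod_cast this
  have hfs : Summable f := by
    refine (summable_condensed_iff_of_nonneg (fun n => ?_) (fun a b ha hab => ?_)).1 ?_
    · have := hlog n
      positivity
    · have h1 := hlog a
      have h2 : Real.log (max a 2 : ℕ) ≤ Real.log (max b 2 : ℕ) := by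
        refine Real.log_le_log ?_ ?_
        · have : 0 < max a 2 := by omega
          exact_mod_cast this
        · have : max a 2 ≤ max b 2 := by omega
          exact_mod_cast this
      simp only [hf]
      gcongr
    · have hs : Summable fun k : ℕ => (Real.log 2 ^ (1 + η))⁻¹ * ((k : ℝ) ^ (1 + η))⁻¹ :=
        (Real.summable_nat_rpow_inv.2 (by linarith)).mul_left _
      refine (summable_congr_atTop ?_).1 hs
      filter_upwards [eventually_ge_atTop 1] with k hk
      have h2 : max (2 ^ k) 2 = 2 ^ k :=
        max_eq_left (by simpa using Nat.pow_le_pow_right (n := 2) (by norm_num) hk)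
      simp only [hf, h2]
      push_cast
      rw [Real.log_pow, Real.mul_rpow (by positivity) (Real.log_nonneg (by norm_num)), mul_inv,
        mul_inv_cancel_left₀ (by positivity), mul_inv, mul_comm]
  refine (summable_congr_atTop ?_).1 hfs
  filter_upwards [eventually_ge_atTop 2] with n hn
  simp only [hf, max_eq_left hn]

/-- The rate `√(n (log n)^(1+η))`. -/
noncomputable def logRate (η : ℝ) (n : ℕ) : ℝ :=
  Real.sqrt ((n : ℝ) * Real.log (n : ℝ) ^ (1 + η))

theorem logRate_sq (η : ℝ) (n : ℕ) : logRate η n ^ 2 = (n : ℝ) * Real.log n ^ (1 + η) :=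
  Real.sq_sqrt (mul_nonneg n.cast_nonneg (Real.rpow_nonneg (Real.log_natCast_nonneg n) _))

theorem logRate_pos (η : ℝ) {n : ℕ} (hn : 2 ≤ n) : 0 < logRate η n := by
  have : 0 < Real.log (n : ℝ) := Real.log_pos (by exact_mod_cast hn)
  have : (0 : ℝ) < n := by positivity
  exact Real.sqrt_pos.2 (by positivity)

theorem summable_sq_inv_logRate {η : ℝ} (hη : 0 < η) :
    Summable fun n => (logRate η (n + 1))⁻¹ ^ 2 := by
  simp_rw [inv_pow, logRate_sq]
  exact (summable_nat_add_iff 1).2 (summable_inv_mul_log_rpow hη)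

theorem tendsto_logRate_atTop {η : ℝ} (hη : 0 < η) : Tendsto (logRate η) atTop atTop := by
  refine Real.tendsto_sqrt_atTop.comp (Tendsto.atTop_mul_atTop₀ tendsto_natCast_atTop_atTop ?_)
  exact (tendsto_rpow_atTop (by linarith)).comp
    (Real.tendsto_log_atTop.comp tendsto_natCast_atTop_atTop)

/-- The growth of the logarithm only helps, so the squared ratio is at most `1 - 1 / (n + 1)`, which
completing the square bounds by the square of the right-hand side. -/
theorem logRate_div_succ_le {η : ℝ} (hη : 0 < η) {n : ℕ} (hn : 2 ≤ n) :
    logRate η n / logRate η (n + 1) ≤ 1 - 1 / (2 * ((n : ℝ) + 1)) := by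
  have hn' : (2 : ℝ) ≤ n := by exact_mod_cast hn
  have h0 : 0 ≤ 1 - 1 / (2 * ((n : ℝ) + 1)) := by
    rw [sub_nonneg, div_le_one (by positivity)]
    linarith
  refine abs_le_of_sq_le_sq' ?_ h0 |>.2
  have hl : 0 < Real.log n := Real.log_pos (by linarith)
  have hll : Real.log n ≤ Real.log ((n : ℝ) + 1) := Real.log_le_log (by linarith) (by linarith)
  rw [div_pow, logRate_sq, logRate_sq]
  push_cast
  have h1 : Real.log n ^ (1 + η) ≤ Real.log ((n : ℝ) + 1) ^ (1 + η) := by gcongr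
  have hpos : 0 < Real.log ((n : ℝ) + 1) ^ (1 + η) := Real.rpow_pos_of_pos (by linarith) _
  calc (n : ℝ) * Real.log n ^ (1 + η) / (((n : ℝ) + 1) * Real.log ((n : ℝ) + 1) ^ (1 + η))
      ≤ (n : ℝ) * Real.log ((n : ℝ) + 1) ^ (1 + η) /
        (((n : ℝ) + 1) * Real.log ((n : ℝ) + 1) ^ (1 + η)) := by gcongr
    _ = 1 - 1 / ((n : ℝ) + 1) := by field_simp; ring
    _ ≤ (1 - 1 / (2 * ((n : ℝ) + 1))) ^ 2 := by
      have : (1 - 1 / (2 * ((n : ℝ) + 1))) ^ 2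
        = 1 - 1 / ((n : ℝ) + 1) + (1 / (2 * ((n : ℝ) + 1))) ^ 2 := by field_simp; ring
      rw [this]
      have := sq_nonneg (1 / (2 * ((n : ℝ) + 1)))
      linarith

/-- A perturbed linear recursion with rate `δ < 1/2` is negligible against `logRate`. -/
theorem tendsto_div_logRate_of_recursion {δ η C l : ℝ} (hδ : δ < 1 / 2) (hη : 0 < η)
    {D ξ e : ℕ → ℝ}
    (hD : ∀ n : ℕ, 1 ≤ n → D (n + 1) = (1 + δ / n) * D n + ξ n + e n)
    (he : ∀ n : ℕ, |e n| ≤ C / n)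
    (hξ : Tendsto (fun n => ∑ k ∈ Finset.range n, (logRate η (k + 1))⁻¹ * ξ k) atTop (𝓝 l)) :
    Tendsto (fun n => D n / logRate η n) atTop (𝓝 0) := by
  have hes : Summable fun n => (logRate η (n + 1))⁻¹ * e n := by
    -- By AM-GM, `(C / n) / b (n + 1)` is at most `(C / n) ^ 2 + 1 / b (n + 1) ^ 2`; at `n = 0` the
    -- hypothesis forces `e 0 = 0`.
    have h1 : Summable fun n : ℕ => C ^ 2 * ((n : ℝ) ^ 2)⁻¹ + (logRate η (n + 1))⁻¹ ^ 2 :=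
      ((Real.summable_nat_pow_inv.2 (by norm_num)).mul_left _).add (summable_sq_inv_logRate hη)
    refine Summable.of_norm_bounded h1 (fun n => ?_)
    rw [Real.norm_eq_abs, abs_mul]
    have h2 : |(logRate η (n + 1))⁻¹| ^ 2 = (logRate η (n + 1))⁻¹ ^ 2 := sq_abs _
    have h3 : C ^ 2 * ((n : ℝ) ^ 2)⁻¹ = (C / n) ^ 2 := by rw [div_pow]; rfl
    rw [h3, ← h2]
    have h4 := he n
    have h5 := abs_nonneg (e n)
    have h6 := abs_nonneg (logRate η (n + 1))⁻¹
    nlinarith [sq_nonneg (|(logRate η (n + 1))⁻¹| - C / n), mul_le_mul_of_nonneg_left h4 h6,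
      mul_nonneg h6 h6, sq_nonneg (C / n)]
  have hx := hξ.add hes.hasSum.tendsto_sum_nat
  simp_rw [← Finset.sum_add_distrib, ← mul_add] at hx
  -- Half of the gap `1/2 - δ`; the other half absorbs the lower-order terms.
  set c : ℝ := (1 / 2 - δ) / 2 with hc
  have hcpos : 0 < c := by rw [hc]; linarith
  -- The two summands ensure `1 + δ / n ≥ 0` and `c * n ≥ |δ| / 2 + c`, respectively.
  obtain ⟨N₀, hN₀⟩ := exists_nat_ge (|δ| + (|δ| / 2 + c) / c)
  set N := max 2 N₀
  set κ : ℕ → ℝ := fun n => 1 - logRate η n / logRate η (n + 1) * (1 + δ / n) with hκ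
  have hnN : ∀ n : ℕ, N ≤ n → 2 ≤ n ∧ |δ| + (|δ| / 2 + c) / c ≤ n := fun n hn =>
    ⟨(le_max_left _ _).trans hn, hN₀.trans (by exact_mod_cast (le_max_right _ _).trans hn)⟩
  have hδn : ∀ n : ℕ, N ≤ n → 0 ≤ 1 + δ / n := by
    intro n hn
    obtain ⟨h2, h3⟩ := hnN n hn
    have h2' : (2 : ℝ) ≤ n := by exact_mod_cast h2
    have h4 : 0 ≤ (|δ| / 2 + c) / c := by positivity
    have : -1 ≤ δ / n := by
      rw [le_div_iff₀ (by linarith)]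
      linarith [neg_abs_le δ]
    linarith
  have hκc : ∀ n : ℕ, N ≤ n → c / n ≤ κ n := by
    intro n hn
    obtain ⟨h2, h3⟩ := hnN n hn
    have h2' : (2 : ℝ) ≤ n := by exact_mod_cast h2
    have h4 : |δ| / 2 + c ≤ c * n := by
      have : (|δ| / 2 + c) / c ≤ n := by linarith [abs_nonneg δ]
      rw [div_le_iff₀ hcpos] at this
      linarith
    have h5 := mul_le_mul_of_nonneg_right (logRate_div_succ_le hη h2) (hδn n hn)
    have h6 : c / n ≤ 1 - (1 - 1 / (2 * ((n : ℝ) + 1))) * (1 + δ / n) := by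
      have : 1 - (1 - 1 / (2 * ((n : ℝ) + 1))) * (1 + δ / n) - c / n
          = (c * n - δ / 2 - c) / (n * ((n : ℝ) + 1)) := by
        field_simp
        rw [hc]
        ring
      have h7 : 0 ≤ (c * n - δ / 2 - c) / (n * ((n : ℝ) + 1)) :=
        div_nonneg (by linarith [le_abs_self δ]) (by positivity)
      linarith
    simp only [hκ]
    linarith
  refine tendsto_zero_of_contracting_recursion (N := N) (κ := κ) (fun n hn => ?_) (fun n hn => ?_)
    (fun n hn => ?_) (fun hs => ?_) hx
  · have h2 := (hnN n hn).1
    have hb := logRate_pos η h2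
    have hb' := logRate_pos η (show 2 ≤ n + 1 by omega)
    rw [hD n (by omega)]
    simp only [hκ]
    field_simp
    ring
  · exact (div_nonneg hcpos.le n.cast_nonneg).trans (hκc n hn)
  · have : 0 ≤ logRate η n / logRate η (n + 1) * (1 + δ / n) :=
      mul_nonneg (div_nonneg (Real.sqrt_nonneg _) (Real.sqrt_nonneg _)) (hδn n hn)
    simp only [hκ]
    linarith
  · have h1 : Summable fun n : ℕ => c / (n : ℝ) := by
      refine Summable.of_norm_bounded_eventually_nat hs ?_
      filter_upwards [eventually_ge_atTop N] with n hn
      rw [Real.norm_of_nonneg (div_nonneg hcpos.le n.cast_nonneg)]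
      exact hκc n hn
    simp_rw [div_eq_mul_inv] at h1
    exact Real.not_summable_natCast_inv ((summable_mul_left_iff hcpos.ne').1 h1)

/-! ### Alternating sums and removal of the oscillating drift -/

/-- The alternating sign, `1` at odd times and `-1` at even times. -/
noncomputable def altSign (k : ℕ) : ℝ := if Odd k then 1 else -1

theorem altSign_succ (k : ℕ) : altSign (k + 1) = -altSign k := by
  by_cases h : Odd k
  · have h' : ¬ Odd (k + 1) := by rw [Nat.odd_add_one]; exact not_not.2 h
    simp [altSign, h, h']
  · have h' : Odd (k + 1) := by rw [Nat.odd_add_one]; exact h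
    simp [altSign, h, h']

theorem altSign_mul_self (k : ℕ) : altSign k * altSign k = 1 := by
  unfold altSign
  split_ifs <;> norm_num

theorem abs_altSign (k : ℕ) : |altSign k| = 1 := by
  unfold altSign
  split_ifs <;> norm_num

theorem abs_sum_altSign_le (n : ℕ) : |∑ k ∈ Finset.Icc 1 n, altSign k| ≤ 1 := by
  have h : ∀ n : ℕ, ∑ k ∈ Finset.Icc 1 n, altSign k = (1 + altSign n) / 2 := by
    intro n
    induction n with
    | zero => simp [altSign]
    | succ n ih =>
      rw [Finset.sum_Icc_succ_top (by omega), ih, altSign_succ]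
      ring
  rw [h]
  unfold altSign
  split_ifs <;> norm_num

/-- The alternating sums of a bounded sequence `z` whose one-step drift is
`γ A n / n + δ (± B n) / n`, where `A` and `B` are the plain and alternating partial sums,
are negligible against `logRate` as soon as the compensated noise is summable along it. -/
theorem tendsto_alternating_sum_div_logRate {γ δ η K l : ℝ} (hδ : δ < 1 / 2) (hη : 0 < η)
    {z ξ A B : ℕ → ℝ} (hz : ∀ k, 1 ≤ k → |z k| ≤ K)
    (hA : ∀ n, A n = ∑ k ∈ Finset.Icc 1 n, z k)
    (hB : ∀ n, B n = ∑ k ∈ Finset.Icc 1 n, altSign k * z k)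
    (hξz : ∀ n : ℕ, 1 ≤ n → ξ n = altSign (n + 1) *
      (z (n + 1) - (γ * (A n / n) + δ * altSign (n + 1) * (B n / n))))
    (hξ : Tendsto (fun n => ∑ k ∈ Finset.range n, (logRate η (k + 1))⁻¹ * ξ k) atTop (𝓝 l)) :
    Tendsto (fun n => B n / logRate η n) atTop (𝓝 0) := by
  have hK : 0 ≤ K := (abs_nonneg _).trans (hz 1 le_rfl)
  have hAn : ∀ n : ℕ, |A n| ≤ n * K := by
    intro n
    rw [hA]
    refine (Finset.abs_sum_le_sum_abs _ _).trans ?_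
    refine (Finset.sum_le_card_nsmul _ _ K fun k hk => hz k (Finset.mem_Icc.1 hk).1).trans ?_
    simp
  have hAn' : ∀ n : ℕ, |A n / n| ≤ K := by
    intro n
    rcases n.eq_zero_or_pos with rfl | hn
    · simpa using hK
    · have : (0 : ℝ) < n := by exact_mod_cast hn
      rw [abs_div, abs_of_pos this, div_le_iff₀ this]
      linarith [hAn n]
  -- Because the sign flips at each step, the increment of the correction cancels the forcing `γ *
  -- altSign (n + 1) * (A n / n)` up to half the increment of `A n / n`, which is `O(1 / n)`.
  set D : ℕ → ℝ := fun n => B n - γ / 2 * altSign n * (A n / n) with hD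
  -- The error is whatever the recursion leaves over; it is zero at `n = 0`, where the bound `C / n`
  -- is zero too.
  set e : ℕ → ℝ := fun n =>
    if n = 0 then 0 else D (n + 1) - (1 + δ / n) * D n - ξ n with he
  have heb : ∀ n : ℕ, |e n| ≤ (|γ| / 2 * ((2 + |δ|) * K)) / n := by
    intro n
    rcases n.eq_zero_or_pos with rfl | hn
    · simp [he]
    have hn' : (0 : ℝ) < n := by exact_mod_cast hn
    have hAs : A (n + 1) = A n + z (n + 1) := by
      rw [hA, hA, Finset.sum_Icc_succ_top (by omega)]
    have hBs : B (n + 1) = B n + altSign (n + 1) * z (n + 1) := by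
      rw [hB, hB, Finset.sum_Icc_succ_top (by omega)]
    have hs : altSign n = -altSign (n + 1) := by rw [altSign_succ, neg_neg]
    have h1 : e n = -(γ / 2) * altSign (n + 1) *
        ((z (n + 1) / ((n : ℝ) + 1) - A n / n / ((n : ℝ) + 1)) + δ * (A n / n) / n) := by
      simp only [he, hn.ne', if_false, hD, hξz n hn, hAs, hBs, hs]
      have := altSign_mul_self (n + 1)
      push_cast
      field_simp
      linear_combination (2 * n * δ * B n * (n + 1)) * this
    rw [h1, abs_mul, abs_mul, abs_altSign, abs_neg, abs_div, abs_two, mul_one,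
      mul_div_assoc (|γ| / 2)]
    refine mul_le_mul_of_nonneg_left ?_ (by positivity)
    have h2 : |z (n + 1) / ((n : ℝ) + 1)| ≤ K / n := by
      rw [abs_div, abs_of_pos (by positivity : (0 : ℝ) < n + 1)]
      gcongr
      · exact hz _ (by omega)
      · linarith
    have h3 : |A n / n / ((n : ℝ) + 1)| ≤ K / n := by
      rw [abs_div, abs_of_pos (by positivity : (0 : ℝ) < n + 1)]
      gcongr
      · exact hAn' n
      · linarith
    have h4 : |δ * (A n / n) / n| ≤ |δ| * K / n := by
      rw [abs_div, abs_mul, abs_of_pos hn']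
      gcongr
      exact hAn' n
    calc _ ≤ (K / n + K / n) + |δ| * K / n :=
          (abs_add_le _ _).trans (add_le_add ((abs_sub _ _).trans (add_le_add h2 h3)) h4)
      _ = (2 + |δ|) * K / n := by ring
  have hDt : Tendsto (fun n => D n / logRate η n) atTop (𝓝 0) := by
    refine tendsto_div_logRate_of_recursion hδ hη (fun n hn => ?_) heb hξ
    simp only [he, show n ≠ 0 by omega, if_false]
    ring
  have hrest : Tendsto (fun n => (γ / 2 * altSign n * (A n / n)) * (logRate η n)⁻¹)
      atTop (𝓝 0) := by
    refine bdd_le_mul_tendsto_zero' (|γ| / 2 * K) (Eventually.of_forall fun n => ?_)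
      (tendsto_logRate_atTop hη).inv_tendsto_atTop
    rw [abs_mul, abs_mul, abs_altSign, abs_div, abs_two, mul_one]
    exact mul_le_mul_of_nonneg_left (hAn' n) (by positivity)
  have := hDt.add hrest
  rw [add_zero] at this
  refine this.congr fun n => ?_
  simp only [hD]
  ring

/-! ### Almost sure convergence of weighted martingale differences -/

/-- A series `∑ w k * ξ k` of bounded martingale differences with square summable weights
converges almost surely. -/
theorem ae_exists_tendsto_sum_of_martingale_difference {Ω : Type*} {m0 : MeasurableSpace Ω}
    {μ : Measure Ω} [IsProbabilityMeasure μ] (ℱ : Filtration ℕ m0) {ξ : ℕ → Ω → ℝ} {w : ℕ → ℝ}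
    {C : ℝ} (hm : ∀ n, StronglyMeasurable[ℱ (n + 1)] (ξ n)) (hC : ∀ n ω, |ξ n ω| ≤ C)
    (hξ : ∀ n, μ[ξ n | ℱ n] =ᵐ[μ] 0) (hw : Summable fun n => w n ^ 2) :
    ∀ᵐ ω ∂μ, ∃ l, Tendsto (fun n => ∑ k ∈ Finset.range n, w k * ξ k ω) atTop (𝓝 l) := by
  set M : ℕ → Ω → ℝ := fun n ω => ∑ k ∈ Finset.range n, w k * ξ k ω with hM
  have hMm : ∀ n, StronglyMeasurable[ℱ n] (M n) := by
    intro n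
    refine Finset.stronglyMeasurable_fun_sum _ fun k hk => ?_
    exact ((hm k).mono (ℱ.mono (Finset.mem_range.1 hk))).const_mul _
  have hMb : ∀ n, ∃ B, ∀ ω, ‖M n ω‖ ≤ B := by
    intro n
    refine ⟨∑ k ∈ Finset.range n, |w k| * C, fun ω => ?_⟩
    refine (norm_sum_le _ _).trans (Finset.sum_le_sum fun k _ => ?_)
    rw [norm_mul, Real.norm_eq_abs, Real.norm_eq_abs]
    gcongr
    exact hC k ω
  have hMs : ∀ n, M (n + 1) = M n + w n • ξ n := by
    intro n
    ext ω
    simp [hM, Finset.sum_range_succ]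
  have hξi : ∀ n, Integrable (ξ n) μ := fun n =>
    Integrable.of_bound ((hm n).mono (ℱ.le _)).aestronglyMeasurable C
      (ae_of_all _ fun ω => hC n ω)
  have hMi : ∀ n, Integrable (M n) μ := fun n => by
    obtain ⟨B, hB⟩ := hMb n
    exact Integrable.of_bound ((hMm n).mono (ℱ.le _)).aestronglyMeasurable B (ae_of_all _ hB)
  have hmart : Martingale M ℱ μ := by
    refine martingale_of_condExp_sub_eq_zero_nat hMm hMi fun n => ?_
    rw [hMs, add_sub_cancel_left]
    filter_upwards [condExp_smul (μ := μ) (w n) (ξ n) (ℱ n), hξ n] with ω h1 h2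
    rw [h1, Pi.smul_apply, h2]
    simp
  -- Orthogonality of the past and the next increment makes the second moments add up in `hbound`.
  have horth : ∀ n, ∫ ω, M n ω * ξ n ω ∂μ = 0 := by
    intro n
    obtain ⟨B, hB⟩ := hMb n
    have h1 := condExp_stronglyMeasurable_mul_of_bound (ℱ.le n) (hMm n) (hξi n) B
      (ae_of_all _ hB)
    have h2 : μ[M n * ξ n | ℱ n] =ᵐ[μ] 0 := by
      filter_upwards [h1, hξ n] with ω h1 h2
      rw [h1, Pi.mul_apply, h2]
      simp
    have h3 := integral_condExp (μ := μ) (f := M n * ξ n) (ℱ.le n)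
    rw [integral_congr_ae h2] at h3
    simpa using h3.symm
  have hMξ : ∀ n, Integrable (fun ω => M n ω * ξ n ω) μ := fun n => by
    obtain ⟨B, hB⟩ := hMb n
    exact (hξi n).bdd_mul ((hMm n).mono (ℱ.le _)).aestronglyMeasurable (ae_of_all _ hB)
  have hM2 : ∀ n, Integrable (fun ω => M n ω ^ 2) μ := fun n => by
    obtain ⟨B, hB⟩ := hMb n
    simp_rw [pow_two]
    exact (hMi n).bdd_mul ((hMm n).mono (ℱ.le _)).aestronglyMeasurable (ae_of_all _ hB)
  have hξ2 : ∀ n, Integrable (fun ω => ξ n ω ^ 2) μ := fun n => by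
    simp_rw [pow_two]
    exact (hξi n).bdd_mul ((hm n).mono (ℱ.le _)).aestronglyMeasurable
      (ae_of_all _ fun ω => hC n ω)
  have hξ2C : ∀ n, ∫ ω, ξ n ω ^ 2 ∂μ ≤ C ^ 2 := by
    intro n
    calc ∫ ω, ξ n ω ^ 2 ∂μ ≤ ∫ _, C ^ 2 ∂μ := by
          refine integral_mono (hξ2 n) (integrable_const _) fun ω => ?_
          exact sq_le_sq' (by linarith [neg_abs_le (ξ n ω), hC n ω])
            ((le_abs_self _).trans (hC n ω))
      _ = C ^ 2 := by simp
  have hbound : ∀ n, ∫ ω, M n ω ^ 2 ∂μ ≤ ∑ k ∈ Finset.range n, w k ^ 2 * C ^ 2 := by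
    intro n
    induction n with
    | zero => simp [hM]
    | succ n ih =>
      have h1 : ∀ ω, M (n + 1) ω ^ 2
          = M n ω ^ 2 + 2 * w n * (M n ω * ξ n ω) + w n ^ 2 * ξ n ω ^ 2 := by
        intro ω
        rw [hMs]
        simp only [Pi.add_apply, Pi.smul_apply, smul_eq_mul]
        ring
      simp_rw [h1]
      have h2 : Integrable (fun ω => M n ω ^ 2 + 2 * w n * (M n ω * ξ n ω)) μ :=
        (hM2 n).add ((hMξ n).const_mul _)
      rw [integral_add h2 ((hξ2 n).const_mul _),
        integral_add (hM2 n) ((hMξ n).const_mul _), integral_const_mul, integral_const_mul,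
        horth n, Finset.sum_range_succ]
      have := mul_le_mul_of_nonneg_left (hξ2C n) (sq_nonneg (w n))
      linarith
  set R : ℝ := 1 + (∑' k, w k ^ 2) * C ^ 2
  have hR : 0 ≤ R := by
    have : 0 ≤ ∑' k, w k ^ 2 := tsum_nonneg fun k => sq_nonneg _
    positivity
  refine hmart.submartingale.exists_ae_tendsto_of_bdd (R := R.toNNReal) fun n => ?_
  rw [eLpNorm_one_eq_lintegral_enorm, ← ofReal_integral_norm_eq_lintegral_enorm (hMi n)]
  refine ENNReal.ofReal_le_ofReal ?_
  -- Martingale convergence needs only an `L¹` bound, which follows from the `L²` bound through `|x|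
  -- ≤ 1 + x ^ 2`.
  calc ∫ ω, ‖M n ω‖ ∂μ ≤ ∫ ω, (1 + M n ω ^ 2) ∂μ := by
        refine integral_mono (hMi n).norm ((integrable_const _).add (hM2 n)) fun ω => ?_
        simp only [Real.norm_eq_abs]
        nlinarith [sq_abs (M n ω), sq_nonneg (|M n ω| - 1), abs_nonneg (M n ω)]
    _ = 1 + ∫ ω, M n ω ^ 2 ∂μ := by rw [integral_add (integrable_const _) (hM2 n)]; simp
    _ ≤ R := by
        have h1 := hbound n
        rw [← Finset.sum_mul] at h1
        have h2 : ∑ k ∈ Finset.range n, w k ^ 2 ≤ ∑' k, w k ^ 2 :=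
          hw.sum_le_tsum _ fun k _ => sq_nonneg _
        have := mul_le_mul_of_nonneg_right h2 (sq_nonneg C)
        simp only [R]
        linarith

/-! ### Centred signed coordinates under one response -/

namespace ERWLattice

variable {d : ℕ} (L : ERWLattice d)

/-- The mean of `φ` under the transition probabilities `stepProb p q k v`. -/
noncomputable def stepMean (p q : ℝ) (φ : EuclideanSpace ℝ (Fin d) → ℝ) (k : ℕ)
    (v : EuclideanSpace ℝ (Fin d)) : ℝ :=
  ∑ w ∈ L.stepsAt k, L.stepProb p q k v w * φ w

theorem neg_mem_Veven {v : EuclideanSpace ℝ (Fin d)} : -v ∈ L.Veven ↔ v ∈ L.Vodd :=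
  (L.mem_Vodd_iff v).symm

theorem neg_mem_Vodd {v : EuclideanSpace ℝ (Fin d)} : -v ∈ L.Vodd ↔ v ∈ L.Veven := by
  rw [L.mem_Vodd_iff, neg_neg]

theorem mem_V_of_mem_stepsAt {k : ℕ} {v : EuclideanSpace ℝ (Fin d)} (hv : v ∈ L.stepsAt k) :
    v ∈ L.V := by
  unfold stepsAt at hv
  split_ifs at hv
  exacts [Or.inl hv, Or.inr hv]

theorem two_le_m : (2 : ℝ) ≤ L.m := by
  unfold m
  exact_mod_cast L.two_le_card

theorem sum_Veven (f : EuclideanSpace ℝ (Fin d) → ℝ) :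
    ∑ v ∈ L.Veven, f v = ∑ v ∈ L.Vodd, f (-v) := by
  refine Finset.sum_bij' (fun v _ => -v) (fun v _ => -v) (fun v hv => L.neg_mem_Vodd.2 hv)
    (fun v hv => L.neg_mem_Veven.2 hv) (fun v _ => neg_neg v) (fun v _ => neg_neg v) ?_
  intro v _
  rw [neg_neg]

/-- The mean of coordinate `i` over `Vodd`. -/
noncomputable def coordMean (i : Fin d) : ℝ := (∑ v ∈ L.Vodd, v i) / L.m

/-- Coordinate `i` of a step made at time `k`, signed and centred. -/
noncomputable def centredCoord (i : Fin d) (k : ℕ) (v : EuclideanSpace ℝ (Fin d)) : ℝ :=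
  altSign k * v i - L.coordMean i

theorem sum_centredCoord (i : Fin d) (k : ℕ) :
    ∑ w ∈ L.stepsAt k, L.centredCoord i k w = 0 := by
  have hm := L.two_le_m
  have h : ∑ w ∈ L.Vodd, (w i - L.coordMean i) = 0 := by
    rw [Finset.sum_sub_distrib, Finset.sum_const, nsmul_eq_mul]
    change _ - (L.m : ℝ) * _ = 0
    rw [coordMean, mul_div_cancel₀ _ (by linarith), sub_self]
  unfold stepsAt centredCoord altSign
  split_ifs
  · simpa using h
  · rw [L.sum_Veven]
    simpa using h

theorem mem_stepsAt_iff {j k : ℕ} {v : EuclideanSpace ℝ (Fin d)} (hv : v ∈ L.stepsAt j) :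
    v ∈ L.stepsAt k ↔ (Odd j ↔ Odd k) := by
  have hd := Finset.disjoint_left.1 L.disjoint_V
  have hd' := Finset.disjoint_right.1 L.disjoint_V
  unfold stepsAt at hv ⊢
  by_cases hj : Odd j <;> by_cases hk : Odd k <;> simp only [hj, hk, if_true, if_false] at hv ⊢
  · simpa using hv
  · simpa using hd hv
  · simpa using hd' hv
  · simpa using hv

theorem sum_ite_mul {s : Finset (EuclideanSpace ℝ (Fin d))} {u : EuclideanSpace ℝ (Fin d)}
    [DecidableEq (EuclideanSpace ℝ (Fin d))]
    (hu : u ∈ s) (a r : ℝ) (f : EuclideanSpace ℝ (Fin d) → ℝ) :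
    ∑ w ∈ s, (if w = u then a else r) * f w = r * ∑ w ∈ s, f w + (a - r) * f u := by
  have h : ∀ w, (if w = u then a else r) * f w = r * f w + if w = u then (a - r) * f u else 0 := by
    intro w
    split_ifs with h
    · rw [h]; ring
    · ring
  simp_rw [h]
  rw [Finset.sum_add_distrib, ← Finset.mul_sum, Finset.sum_ite_eq' s u, if_pos hu]

/-- The transition law is constant except at one favoured step, and the constant part integrates to
zero by centring. What remains is the excess weight of that step: `p - (1 - p) / (m - 1) = α` at
`v`, or `β` at `-v`. The reflected step has the same centred coordinate since the sign flips as
well, and `γ ± δ` encodes both cases. -/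
theorem stepMean_centredCoord (p q : ℝ) (i : Fin d) {j k : ℕ} {v : EuclideanSpace ℝ (Fin d)}
    (hv : v ∈ L.stepsAt j) :
    L.stepMean p q (L.centredCoord i k) k v =
      (L.gamma p q + L.delta p q * (altSign k * altSign j)) * L.centredCoord i j v := by
  classical
  have hm := L.two_le_m
  have hm' : (L.m : ℝ) - 1 ≠ 0 := by linarith
  have hab : ∀ t : ℝ, t - (1 - t) / ((L.m : ℝ) - 1) = ((L.m : ℝ) * t - 1) / ((L.m : ℝ) - 1) := by
    intro t
    field_simp
    ring
  have hiff := L.mem_stepsAt_iff (k := k) hv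
  unfold stepMean stepProb
  by_cases h : v ∈ L.stepsAt k
  · have hs : altSign k = altSign j := by
      unfold altSign
      simp only [hiff.1 h]
    simp only [h, if_true]
    have := sum_ite_mul h p ((1 - p) / ((L.m : ℝ) - 1)) (L.centredCoord i k)
    refine (Eq.trans ?_ this).trans ?_
    · refine Finset.sum_congr rfl fun w _ => ?_
      congr
    rw [L.sum_centredCoord, hab, hs, altSign_mul_self]
    unfold centredCoord gamma delta alpha
    rw [hs]
    ring
  · have hs : altSign k = -altSign j := by
      unfold altSign
      by_cases hj : Odd j <;> by_cases hk : Odd k <;> simp [hj, hk] at h hiff ⊢ <;> tauto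
    have hu : -v ∈ L.stepsAt k := by
      by_cases hj : Odd j <;> by_cases hk : Odd k <;>
        simp only [stepsAt, hj, hk, if_true, if_false] at h hv ⊢
      · exact absurd hv h
      · exact L.neg_mem_Veven.2 hv
      · exact L.neg_mem_Vodd.2 hv
      · exact absurd hv h
    simp only [h, if_false]
    have := sum_ite_mul hu q ((1 - q) / ((L.m : ℝ) - 1)) (L.centredCoord i k)
    refine (Eq.trans ?_ this).trans ?_
    · refine Finset.sum_congr rfl fun w _ => ?_
      congr
    have hss : altSign k * altSign j = -1 := by rw [hs, neg_mul, altSign_mul_self]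
    rw [L.sum_centredCoord, hab, hss]
    unfold centredCoord gamma delta beta
    rw [hs]
    simp only [PiLp.neg_apply]
    ring

theorem exists_abs_centredCoord_le (i : Fin d) :
    ∃ K, ∀ k, ∀ v ∈ L.stepsAt k, |L.centredCoord i k v| ≤ K := by
  refine ⟨(∑ w ∈ L.Vodd, |w i|) + |L.coordMean i|, fun k v hv => ?_⟩
  have h : |v i| ≤ ∑ w ∈ L.Vodd, |w i| := by
    have hle : ∀ u ∈ L.Vodd, |u i| ≤ ∑ w ∈ L.Vodd, |w i| := fun u hu =>
      Finset.single_le_sum (f := fun w : EuclideanSpace ℝ (Fin d) => |w i|)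
        (fun w _ => abs_nonneg _) hu
    rcases L.mem_V_of_mem_stepsAt hv with h | h
    · exact hle v h
    · simpa using hle _ (L.neg_mem_Vodd.2 h)
  unfold centredCoord
  refine (abs_sub _ _).trans ?_
  rw [abs_mul, abs_altSign, one_mul]
  linarith

end ERWLattice

/-! ### Blocks, filtration and the conditional law of the next step -/

theorem integral_comp_of_mem_finset {Ω E : Type*} [MeasurableSpace Ω] [MeasurableSpace E]
    [MeasurableSingletonClass E] {μ : Measure Ω} [IsFiniteMeasure μ] {f : Ω → E}
    (hf : Measurable f) {s : Finset E} (hs : ∀ ω, f ω ∈ s) (φ : E → ℝ) :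
    ∫ ω, φ (f ω) ∂μ = ∑ w ∈ s, μ.real {ω | f ω = w} * φ w := by
  classical
  have hms : ∀ w, MeasurableSet {ω | f ω = w} := fun w => hf (measurableSet_singleton w)
  have h : ∀ ω, φ (f ω) = ∑ w ∈ s, Set.indicator {ω | f ω = w} (fun _ => φ w) ω := by
    intro ω
    simp only [Set.indicator_apply, Set.mem_ofPred_eq]
    rw [Finset.sum_ite_eq s (f ω), if_pos (hs ω)]
  simp_rw [h]
  rw [integral_finsetSum _ fun w _ => (integrable_const _).indicator (hms w)]
  refine Finset.sum_congr rfl fun w _ => ?_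
  rw [integral_indicator_const _ (hms w), smul_eq_mul]

section

variable {d : ℕ} {Ω : Type*} {L : ERWLattice d} {X : ℕ → Ω → EuclideanSpace ℝ (Fin d)}
  {U : ℕ → Ω → ℕ} {G : ℕ → EuclideanSpace ℝ (Fin d) → Ω → EuclideanSpace ℝ (Fin d)}

theorem measurable_U_erwBlock {n : ℕ} (hn : 1 ≤ n) : Measurable[erwBlock L X U G n] (U n) := by
  obtain ⟨n, rfl⟩ := Nat.exists_eq_add_of_le' hn
  exact (comap_measurable (U (n + 1))).mono le_sup_left le_rfl

theorem measurable_G_erwBlock {n : ℕ} (hn : 1 ≤ n) {v : EuclideanSpace ℝ (Fin d)}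
    (hv : v ∈ L.V) : Measurable[erwBlock L X U G n] (G (n + 1) v) := by
  obtain ⟨n, rfl⟩ := Nat.exists_eq_add_of_le' hn
  refine (comap_measurable (G (n + 1 + 1) v)).mono ?_ le_rfl
  refine le_sup_of_le_right ?_
  exact le_iSup₂_of_le (f := fun v (_ : v ∈ L.V) =>
    MeasurableSpace.comap (G (n + 2) v) inferInstance) v hv le_rfl

end

namespace IsERW

variable {d : ℕ} {Ω : Type*} [mΩ : MeasurableSpace Ω] {μ : Measure Ω} {L : ERWLattice d}
  {p q : ℝ} {X : ℕ → Ω → EuclideanSpace ℝ (Fin d)} {U : ℕ → Ω → ℕ}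
  {G : ℕ → EuclideanSpace ℝ (Fin d) → Ω → EuclideanSpace ℝ (Fin d)}

theorem step_mem (hX : IsERW μ L p q X U G) {k : ℕ} (hk : 1 ≤ k) (ω : Ω) :
    X k ω ∈ L.stepsAt k := by
  induction k using Nat.strong_induction_on with
  | _ k ih =>
    obtain rfl | ⟨n, hn, rfl⟩ : k = 1 ∨ ∃ n, 1 ≤ n ∧ k = n + 1 := by
      rcases hk.eq_or_lt with h | h
      · exact Or.inl h.symm
      · exact Or.inr ⟨k - 1, by omega, by omega⟩
    · simpa [ERWLattice.stepsAt] using hX.first_mem ω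
    · rw [hX.step n hn]
      have hU := Finset.mem_Icc.1 (hX.U_mem n hn ω)
      exact hX.G_mem _ (by omega) _ (L.mem_V_of_mem_stepsAt (ih _ (by omega) hU.1)) ω

theorem erwBlock_le (hX : IsERW μ L p q X U G) (n : ℕ) : erwBlock L X U G n ≤ mΩ := by
  cases n with
  | zero => exact hX.measurable_first.comap_le
  | succ n =>
    refine sup_le (hX.measurable_U _ (by omega)).comap_le (iSup₂_le fun v hv => ?_)
    exact (hX.measurable_G _ (by omega) v hv).comap_le

/-- The information available at time `n`: the blocks of randomness with index below `n`. -/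
def filtration (hX : IsERW μ L p q X U G) : Filtration ℕ mΩ where
  seq n := ⨆ i ∈ Set.Iio n, erwBlock L X U G i
  mono' _ _ h := biSup_mono fun _ hi => lt_of_lt_of_le hi h
  le' _ := iSup₂_le fun i _ => hX.erwBlock_le i

theorem erwBlock_le_filtration (hX : IsERW μ L p q X U G) {i n : ℕ} (h : i < n) :
    erwBlock L X U G i ≤ hX.filtration n :=
  le_iSup₂_of_le (f := fun i (_ : i ∈ Set.Iio n) => erwBlock L X U G i) i h le_rfl

/-- Block `n` carries `U n` and the responses `G (n + 1)`, so it is the fresh randomness behind `X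
(n + 1)`, whereas the filtration at `n` uses only blocks below `n`, which determine `X 1, …, X n`.
-/
theorem indep_erwBlock_filtration (hX : IsERW μ L p q X U G) (n : ℕ) :
    Indep (erwBlock L X U G n) (hX.filtration n) μ := by
  have h := indep_iSup_of_disjoint hX.erwBlock_le hX.indep_blocks
    (S := {n}) (T := Set.Iio n) (by simp)
  rw [iSup_singleton] at h
  exact h

open Classical in
/-- A function of the next step, split according to the remembered time and step. -/
theorem comp_step_eq_sum (hX : IsERW μ L p q X U G) {F : Type*} [AddCommMonoid F]
    (f : EuclideanSpace ℝ (Fin d) → F) {n : ℕ} (hn : 1 ≤ n) (ω : Ω) :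
    f (X (n + 1) ω) = ∑ j ∈ Finset.Icc 1 n, ∑ v ∈ L.stepsAt j,
      if X j ω = v then (if U n ω = j then f (G (n + 1) v ω) else 0) else 0 := by
  have h : ∀ j ∈ Finset.Icc 1 n, (∑ v ∈ L.stepsAt j,
      if X j ω = v then (if U n ω = j then f (G (n + 1) v ω) else 0) else 0)
      = if U n ω = j then f (G (n + 1) (X j ω) ω) else 0 := by
    intro j hj
    rw [Finset.sum_ite_eq, if_pos (hX.step_mem (Finset.mem_Icc.1 hj).1 ω)]
  rw [Finset.sum_congr rfl h, Finset.sum_ite_eq, if_pos (hX.U_mem n hn ω), hX.step n hn]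

theorem measurable_step (hX : IsERW μ L p q X U G) {n : ℕ} (hn : 1 ≤ n) :
    Measurable[hX.filtration n] (X n) := by
  classical
  induction n using Nat.strong_induction_on with
  | _ n ih =>
    obtain rfl | ⟨n, hn', rfl⟩ : n = 1 ∨ ∃ k, 1 ≤ k ∧ n = k + 1 := by
      rcases hn.eq_or_lt with h | h
      · exact Or.inl h.symm
      · exact Or.inr ⟨n - 1, by omega, by omega⟩
    · exact (comap_measurable (X 1)).mono (hX.erwBlock_le_filtration (i := 0) one_pos) le_rfl
    · have hle := hX.erwBlock_le_filtration (Nat.lt_succ_self n)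
      have h := funext (hX.comp_step_eq_sum id hn')
      change Measurable[hX.filtration (n + 1)] fun ω => id (X (n + 1) ω)
      rw [h]
      refine Finset.measurable_fun_sum _ fun j hj => Finset.measurable_fun_sum _ fun v hv => ?_
      have hj' := Finset.mem_Icc.1 hj
      refine Measurable.ite ?_ (Measurable.ite ?_ ?_ measurable_const) measurable_const
      · exact ((ih j (by omega) hj'.1).mono (hX.filtration.mono (by omega)) le_rfl)
          (measurableSet_singleton v)
      · exact ((measurable_U_erwBlock hn').mono hle le_rfl) (measurableSet_singleton j)
      · exact (measurable_G_erwBlock hn' (L.mem_V_of_mem_stepsAt hv)).mono hle le_rfl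

/-- With `j` and `v` frozen, independence of `U n` from the single variable `G (n + 1) v` suffices
to factor the integral. -/
theorem integral_response (hX : IsERW μ L p q X U G) [IsProbabilityMeasure μ]
    {φ : EuclideanSpace ℝ (Fin d) → ℝ} (hφ : Measurable φ) {n j : ℕ} (hn : 1 ≤ n)
    (hj : j ∈ Finset.Icc 1 n) {v : EuclideanSpace ℝ (Fin d)} (hv : v ∈ L.V) :
    ∫ ω, (if U n ω = j then (1 : ℝ) else 0) * φ (G (n + 1) v ω) ∂μ
      = 1 / n * L.stepMean p q φ (n + 1) v := by
  have hU := hX.measurable_U n hn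
  have hG := hX.measurable_G (n + 1) (by omega) v hv
  have hind : Measurable fun k : ℕ => if k = j then (1 : ℝ) else 0 := measurable_from_top
  have h := ((hX.indep_U_G n hn v hv).comp hind hφ).integral_fun_mul_eq_mul_integral
    (hind.comp hU).aestronglyMeasurable (hφ.comp hG).aestronglyMeasurable
  refine h.trans ?_
  congr 1
  · refine (integral_comp_of_mem_finset hU (hX.U_mem n hn) fun k => if k = j then (1 : ℝ) else 0
      ).trans ?_
    simp only [mul_ite, mul_one, mul_zero]
    rw [Finset.sum_ite_eq' _ j, if_pos hj, hX.U_law n hn j hj]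
  · refine (integral_comp_of_mem_finset hG (hX.G_mem _ (by omega) v hv) φ).trans ?_
    exact Finset.sum_congr rfl fun w hw => by rw [hX.G_law _ (by omega) v hv w hw]

/-- The conditional mean of a function of the next step, given the past. -/
theorem condExp_comp_step (hX : IsERW μ L p q X U G) [IsProbabilityMeasure μ]
    {φ : EuclideanSpace ℝ (Fin d) → ℝ} (hφ : Measurable φ) {n : ℕ} (hn : 1 ≤ n) :
    μ[fun ω => φ (X (n + 1) ω) | hX.filtration n] =ᵐ[μ]
      fun ω => 1 / n * ∑ j ∈ Finset.Icc 1 n, L.stepMean p q φ (n + 1) (X j ω) := by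
  classical
  -- Splitting on the value of the remembered step separates past from fresh randomness: `I j v`
  -- depends on the past, `H j v` on block `n`, so conditioning replaces `H j v` by its mean.
  set I : ℕ → EuclideanSpace ℝ (Fin d) → Ω → ℝ := fun j v ω => if X j ω = v then 1 else 0 with hI
  set H : ℕ → EuclideanSpace ℝ (Fin d) → Ω → ℝ := fun j v ω =>
    (if U n ω = j then (1 : ℝ) else 0) * φ (G (n + 1) v ω) with hH
  have hIm : ∀ j ∈ Finset.Icc 1 n, ∀ v, StronglyMeasurable[hX.filtration n] (I j v) := by
    intro j hj v
    have hj' := Finset.mem_Icc.1 hj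
    refine Measurable.stronglyMeasurable ?_
    exact Measurable.ite (((hX.measurable_step hj'.1).mono (hX.filtration.mono hj'.2) le_rfl)
      (measurableSet_singleton v)) measurable_const measurable_const
  have hIb : ∀ j v ω, ‖I j v ω‖ ≤ 1 := by
    intro j v ω
    simp only [hI]
    split_ifs <;> simp
  have hHm : ∀ j, ∀ v ∈ L.V, StronglyMeasurable[erwBlock L X U G n] (H j v) := by
    intro j v hv
    refine Measurable.stronglyMeasurable ?_
    exact (Measurable.ite (measurable_U_erwBlock hn (measurableSet_singleton j)) measurable_const
      measurable_const).mul (hφ.comp (measurable_G_erwBlock hn hv))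
  have hHi : ∀ j, ∀ v ∈ L.V, Integrable (H j v) μ := by
    intro j v hv
    refine Integrable.of_bound ((hHm j v hv).mono (hX.erwBlock_le n)).aestronglyMeasurable
      (∑ w ∈ L.stepsAt (n + 1), |φ w|) (ae_of_all _ fun ω => ?_)
    have h1 : |φ (G (n + 1) v ω)| ≤ ∑ w ∈ L.stepsAt (n + 1), |φ w| :=
      Finset.single_le_sum (f := fun w => |φ w|) (fun w _ => abs_nonneg _)
        (hX.G_mem _ (by omega) v hv ω)
    simp only [hH]
    split_ifs
    · simpa using h1
    · simpa using (abs_nonneg _).trans h1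
  have hIH : ∀ j ∈ Finset.Icc 1 n, ∀ v ∈ L.V, Integrable (I j v * H j v) μ := by
    intro j hj v hv
    exact (hHi j v hv).bdd_mul ((hIm j hj v).mono (hX.filtration.le n)).aestronglyMeasurable
      (ae_of_all _ (hIb j v))
  have hcond : ∀ j ∈ Finset.Icc 1 n, ∀ v ∈ L.V, μ[I j v * H j v | hX.filtration n] =ᵐ[μ]
      fun ω => I j v ω * (1 / n * L.stepMean p q φ (n + 1) v) := by
    intro j hj v hv
    have h1 := condExp_stronglyMeasurable_mul_of_bound (hX.filtration.le n) (hIm j hj v)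
      (hHi j v hv) 1 (ae_of_all _ (hIb j v))
    have h2 := condExp_indep_eq (hX.erwBlock_le n) (hX.filtration.le n) (hHm j v hv)
      (hX.indep_erwBlock_filtration n)
    filter_upwards [h1, h2] with ω h1 h2
    rw [h1, Pi.mul_apply, h2, hX.integral_response hφ hn hj hv]
  have hsum : (fun ω => φ (X (n + 1) ω))
      = ∑ j ∈ Finset.Icc 1 n, ∑ v ∈ L.stepsAt j, I j v * H j v := by
    ext ω
    rw [hX.comp_step_eq_sum φ hn ω]
    simp only [Finset.sum_apply, Pi.mul_apply, hI, hH, ite_mul, one_mul, zero_mul]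
  rw [hsum]
  have h1 := condExp_finsetSum (μ := μ) (s := Finset.Icc 1 n)
    (f := fun j => ∑ v ∈ L.stepsAt j, I j v * H j v)
    (fun j hj => integrable_finsetSum' _ fun v hv => hIH j hj v (L.mem_V_of_mem_stepsAt hv))
    (hX.filtration n)
  have h2 : ∀ j ∈ Finset.Icc 1 n, μ[∑ v ∈ L.stepsAt j, I j v * H j v | hX.filtration n] =ᵐ[μ]
      ∑ v ∈ L.stepsAt j, μ[I j v * H j v | hX.filtration n] := fun j hj =>
    condExp_finsetSum (fun v hv => hIH j hj v (L.mem_V_of_mem_stepsAt hv)) _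
  have h2' : ∀ᵐ ω ∂μ, ∀ j ∈ Finset.Icc 1 n,
      μ[∑ v ∈ L.stepsAt j, I j v * H j v | hX.filtration n] ω =
        (∑ v ∈ L.stepsAt j, μ[I j v * H j v | hX.filtration n]) ω :=
    (ae_ball_iff (Finset.countable_toSet _)).2 h2
  have h3 : ∀ᵐ ω ∂μ, ∀ j ∈ Finset.Icc 1 n, ∀ v ∈ L.stepsAt j,
      μ[I j v * H j v | hX.filtration n] ω = I j v ω * (1 / n * L.stepMean p q φ (n + 1) v) :=
    (ae_ball_iff (Finset.countable_toSet _)).2 fun j hj =>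
      (ae_ball_iff (Finset.countable_toSet _)).2 fun v hv =>
        hcond j hj v (L.mem_V_of_mem_stepsAt hv)
  filter_upwards [h1, h2', h3] with ω h1 h2 h3
  rw [h1, Finset.sum_apply, Finset.mul_sum]
  refine Finset.sum_congr rfl fun j hj => ?_
  rw [h2 j hj, Finset.sum_apply, Finset.sum_congr rfl (h3 j hj)]
  simp only [hI, ite_mul, one_mul, zero_mul]
  rw [Finset.sum_ite_eq, if_pos (hX.step_mem (Finset.mem_Icc.1 hj).1 ω)]

end IsERW

/-! ### From centred coordinates back to the walk -/

theorem EuclideanSpace.norm_le_sum_abs {d : ℕ} (x : EuclideanSpace ℝ (Fin d)) :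
    ‖x‖ ≤ ∑ i, |x i| := by
  rw [EuclideanSpace.norm_eq, Real.sqrt_le_left (Finset.sum_nonneg fun i _ => abs_nonneg _), sq,
    Finset.sum_mul]
  refine Finset.sum_le_sum fun i hi => ?_
  rw [Real.norm_eq_abs, sq]
  exact mul_le_mul_of_nonneg_left
    (Finset.single_le_sum (f := fun j => |x j|) (fun j _ => abs_nonneg _) hi) (abs_nonneg _)

namespace IsERW

variable {d : ℕ} {Ω : Type*} [mΩ : MeasurableSpace Ω] {μ : Measure Ω} {L : ERWLattice d}
  {p q : ℝ} {X : ℕ → Ω → EuclideanSpace ℝ (Fin d)} {U : ℕ → Ω → ℕ}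
  {G : ℕ → EuclideanSpace ℝ (Fin d) → Ω → EuclideanSpace ℝ (Fin d)}

/-- The conditional mean of the centred signed step at time `n + 1`. -/
theorem condExp_centredCoord (hX : IsERW μ L p q X U G) [IsProbabilityMeasure μ] (i : Fin d)
    {n : ℕ} (hn : 1 ≤ n) :
    μ[fun ω => L.centredCoord i (n + 1) (X (n + 1) ω) | hX.filtration n] =ᵐ[μ] fun ω =>
      L.gamma p q * ((∑ k ∈ Finset.Icc 1 n, L.centredCoord i k (X k ω)) / n) +
      L.delta p q * altSign (n + 1) *
        ((∑ k ∈ Finset.Icc 1 n, altSign k * L.centredCoord i k (X k ω)) / n) := by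
  have hφ : Measurable (L.centredCoord i (n + 1)) := by
    unfold ERWLattice.centredCoord
    fun_prop
  filter_upwards [hX.condExp_comp_step hφ hn] with ω h
  rw [h, Finset.sum_congr rfl fun j hj =>
    L.stepMean_centredCoord p q i (hX.step_mem (Finset.mem_Icc.1 hj).1 ω)]
  simp_rw [add_mul]
  rw [Finset.sum_add_distrib, ← Finset.mul_sum]
  have h2 : ∀ k, L.delta p q * (altSign (n + 1) * altSign k) * L.centredCoord i k (X k ω)
      = L.delta p q * altSign (n + 1) * (altSign k * L.centredCoord i k (X k ω)) := fun k => by ring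
  simp_rw [h2]
  rw [← Finset.mul_sum]
  ring

/-- Every coordinate of the position is negligible against `logRate`. -/
theorem ae_tendsto_coord_div_logRate (hX : IsERW μ L p q X U G) [IsProbabilityMeasure μ]
    (hδ : L.delta p q < 1 / 2) {η : ℝ} (hη : 0 < η) (i : Fin d) :
    ∀ᵐ ω ∂μ, Tendsto (fun n => erwPosition X n ω i / logRate η n) atTop (𝓝 0) := by
  set z : ℕ → Ω → ℝ := fun k ω => L.centredCoord i k (X k ω) with hz
  set A : ℕ → Ω → ℝ := fun n ω => ∑ k ∈ Finset.Icc 1 n, z k ω with hA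
  set B : ℕ → Ω → ℝ := fun n ω => ∑ k ∈ Finset.Icc 1 n, altSign k * z k ω with hB
  set Y : ℕ → Ω → ℝ := fun n ω =>
    L.gamma p q * (A n ω / n) + L.delta p q * altSign (n + 1) * (B n ω / n) with hY
  -- The drift formula starts with the second step, so the noise at index `0` is set to zero; the
  -- recursion is used only from `n = 1`.
  set ξ : ℕ → Ω → ℝ := fun n => if n = 0 then 0 else altSign (n + 1) • (z (n + 1) - Y n) with hξdef
  obtain ⟨K, hK⟩ := L.exists_abs_centredCoord_le i
  have hzK : ∀ k, 1 ≤ k → ∀ ω, |z k ω| ≤ K := fun k hk ω => hK k _ (hX.step_mem hk ω)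
  have hzm : ∀ k n, 1 ≤ k → k ≤ n → StronglyMeasurable[hX.filtration n] (z k) := by
    intro k n hk hkn
    have h1 : Measurable (L.centredCoord i k) := by
      unfold ERWLattice.centredCoord
      fun_prop
    exact (h1.comp ((hX.measurable_step hk).mono (hX.filtration.mono hkn) le_rfl)).stronglyMeasurable
  have hYm : ∀ n, StronglyMeasurable[hX.filtration n] (Y n) := by
    intro n
    have hAm : StronglyMeasurable[hX.filtration n] (A n) :=
      Finset.stronglyMeasurable_fun_sum _ fun k hk =>
        hzm k n (Finset.mem_Icc.1 hk).1 (Finset.mem_Icc.1 hk).2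
    have hBm : StronglyMeasurable[hX.filtration n] (B n) :=
      Finset.stronglyMeasurable_fun_sum _ fun k hk =>
        (hzm k n (Finset.mem_Icc.1 hk).1 (Finset.mem_Icc.1 hk).2).const_mul _
    simp only [hY, div_eq_mul_inv]
    exact ((hAm.mul_const _).const_mul _).add ((hBm.mul_const _).const_mul _)
  have hmean : ∀ (f : ℕ → ℝ) (n : ℕ), 1 ≤ n → (∀ k, 1 ≤ k → |f k| ≤ K) →
      |(∑ k ∈ Finset.Icc 1 n, f k) / n| ≤ K := by
    intro f n hn hf
    have hn' : (0 : ℝ) < n := by exact_mod_cast hn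
    rw [abs_div, abs_of_pos hn', div_le_iff₀ hn']
    refine (Finset.abs_sum_le_sum_abs _ _).trans ?_
    refine (Finset.sum_le_card_nsmul _ _ K fun k hk => hf k (Finset.mem_Icc.1 hk).1).trans ?_
    simp [mul_comm]
  have hYb : ∀ n, 1 ≤ n → ∀ ω, |Y n ω| ≤ |L.gamma p q| * K + |L.delta p q| * K := by
    intro n hn ω
    refine (abs_add_le _ _).trans ?_
    rw [abs_mul, abs_mul, abs_mul, abs_altSign, mul_one]
    gcongr
    · exact hmean _ n hn fun k hk => hzK k hk ω
    · refine hmean _ n hn fun k hk => ?_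
      rw [abs_mul, abs_altSign, one_mul]
      exact hzK k hk ω
  have hξm : ∀ n, StronglyMeasurable[hX.filtration (n + 1)] (ξ n) := by
    intro n
    simp only [hξdef]
    split_ifs
    · exact stronglyMeasurable_zero
    · exact ((hzm _ _ (by omega) le_rfl).sub
        ((hYm n).mono (hX.filtration.mono (Nat.le_succ n)))).const_smul _
  have hξC : ∀ n ω, |ξ n ω| ≤ max 0 (K + (|L.gamma p q| * K + |L.delta p q| * K)) := by
    intro n ω
    simp only [hξdef]
    split_ifs with h
    · simp
    · refine le_max_of_le_right ?_
      rw [Pi.smul_apply, smul_eq_mul, abs_mul, abs_altSign, one_mul]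
      exact (abs_sub _ _).trans (add_le_add (hzK _ (by omega) ω) (hYb n (by omega) ω))
  have hξ0 : ∀ n, μ[ξ n | hX.filtration n] =ᵐ[μ] 0 := by
    intro n
    simp only [hξdef]
    split_ifs with h
    · rw [condExp_zero]
    · have hn : 1 ≤ n := by omega
      have hzi : Integrable (z (n + 1)) μ :=
        Integrable.of_bound ((hzm (n + 1) (n + 1) (by omega) le_rfl).mono
          (hX.filtration.le _)).aestronglyMeasurable K (ae_of_all _ fun ω => hzK _ (by omega) ω)
      have hYi : Integrable (Y n) μ :=
        Integrable.of_bound ((hYm n).mono (hX.filtration.le _)).aestronglyMeasurable _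
          (ae_of_all _ fun ω => hYb n hn ω)
      filter_upwards [condExp_smul (μ := μ) (altSign (n + 1)) (z (n + 1) - Y n) (hX.filtration n),
        condExp_sub hzi hYi (hX.filtration n), hX.condExp_centredCoord i hn] with ω h1 h2 h3
      rw [h1, Pi.smul_apply, h2, Pi.sub_apply, h3,
        condExp_of_stronglyMeasurable (hX.filtration.le n) (hYm n) hYi]
      simp [hY, hA, hB, hz]
  filter_upwards [ae_exists_tendsto_sum_of_martingale_difference hX.filtration hξm hξC hξ0
    (summable_sq_inv_logRate hη)] with ω ⟨l, hl⟩
  have hBt := tendsto_alternating_sum_div_logRate (γ := L.gamma p q) hδ hη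
    (fun k hk => hzK k hk ω) (fun n => rfl) (fun n => rfl)
    (fun n hn => by simp only [hξdef, show n ≠ 0 by omega, if_false]; rfl) hl
  have hrest : Tendsto (fun n => (L.coordMean i * ∑ k ∈ Finset.Icc 1 n, altSign k) *
      (logRate η n)⁻¹) atTop (𝓝 0) := by
    refine bdd_le_mul_tendsto_zero' (|L.coordMean i| * 1) (Eventually.of_forall fun n => ?_)
      (tendsto_logRate_atTop hη).inv_tendsto_atTop
    rw [abs_mul]
    exact mul_le_mul_of_nonneg_left (abs_sum_altSign_le n) (abs_nonneg _)
  -- Since `altSign k` squares to one, undoing the sign and the centring gives the coordinate as `B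
  -- n` plus `coordMean` times an alternating sum bounded by one.
  have := hBt.add hrest
  rw [add_zero] at this
  refine this.congr fun n => ?_
  rw [← div_eq_mul_inv, ← add_div, Finset.mul_sum, ← Finset.sum_add_distrib]
  congr 1
  simp only [erwPosition, WithLp.ofLp_sum, Finset.sum_apply]
  refine Finset.sum_congr rfl fun k _ => ?_
  simp only [hz, ERWLattice.centredCoord]
  linear_combination X k ω i * altSign_mul_self k

end IsERW

theorem mainTheorem6 {d : ℕ} {Ω : Type*} [MeasurableSpace Ω]
    (μ : Measure Ω) [IsProbabilityMeasure μ]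
    (L : ERWLattice d) (p q : ℝ) (hp : p ∈ Set.Icc (0 : ℝ) 1) (hq : q ∈ Set.Icc (0 : ℝ) 1)
    (X : ℕ → Ω → EuclideanSpace ℝ (Fin d)) (U : ℕ → Ω → ℕ)
    (G : ℕ → EuclideanSpace ℝ (Fin d) → Ω → EuclideanSpace ℝ (Fin d))
    (hX : IsERW μ L p q X U G)
    (hγ : L.gamma p q < 1) (hδ : L.delta p q < 1 / 2) (η : ℝ) (hη : 0 < η) :
    ∀ᵐ ω ∂μ, (fun n : ℕ => ‖erwPosition X n ω‖) =o[atTop]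
      (fun n : ℕ => Real.sqrt ((n : ℝ) * Real.log (n : ℝ) ^ (1 + η))) := by
  filter_upwards [ae_all_iff.2 fun i => hX.ae_tendsto_coord_div_logRate hδ hη i] with ω h
  change _ =o[atTop] logRate η
  -- The rate vanishes at `n = 0` and `n = 1`, so dividing by it is legitimate only eventually.
  have hne : ∀ᶠ n in atTop, logRate η n = 0 → erwPosition X n ω = 0 := by
    filter_upwards [eventually_ge_atTop 2] with n hn h0
    exact absurd h0 (logRate_pos η hn).ne'
  have hcoord : ∀ i, (fun n => |erwPosition X n ω i|) =o[atTop] logRate η := by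
    intro i
    refine IsLittleO.abs_left ((isLittleO_iff_tendsto' ?_).2 (h i))
    filter_upwards [hne] with n hn h0
    rw [hn h0]
    rfl
  refine (IsBigO.of_norm_le fun n => ?_).trans_isLittleO
    (IsLittleO.sum (s := Finset.univ) fun i _ => hcoord i)
  rw [norm_norm, Finset.sum_apply]
  exact EuclideanSpace.norm_le_sum_abs _
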